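/- Let $K\subset\mathbb{R}^3$ be a bounded convex set with the origin in its interior, and let $\mathbb{D}=\partial K$ be its boundary surface. Suppose that $\mathbb{D}=\bigcup_{i=1}^n\mathbb{D}_i$ with pairwise disjoint Borel sets $\mathbb{D}_i$, each contained in a graph $\{z=\tilde g_i(x,y)\}$ of a function $\tilde g_i:\mathbb{R}^2\to\mathbb{R}$ which, for surface-almost every $(x,y,z)\in\mathbb{D}_i$, is differentiable at $(x,y)$. Let $\lambda$ denote surface area (two-dimensional Hausdorff measure). For a surface $S\subset\mathbb{R}^3$ and a locally integrable $\rho:S\to[0,\infty)$, a Poisson process on $S$ with intensity function $\rho$ is a random locally finite subset $X$ of $S$ such that the number of points of $X$ in a Borel set $B\subseteq S$ with $\mu(B)=\int_B\rho\,d\lambda<\infty$ is Poisson distributed with mean $\mu(B)$, and the numbers of points in disjoint Borel subsets of $S$ are independent. Let $X$ be a Poisson process on $\mathbb{D}$ with intensity function $\rho$, and let $f(\mathbf{x})=\mathbf{x}/\|\mathbf{x}\|$. Then $f:\mathbb{D}\to\mathbb{S}^2$ is a bijection, and $Y=f(X)=\{\mathbf{x}/\|\mathbf{x}\|:\mathbf{x}\in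 X\}$ is a Poisson process on $\mathbb{S}^2$ with intensity function $$\rho^*(\mathbf{u})=\rho(f^{-1}(\mathbf{u}))\;l_i(f^{-1}(\mathbf{u}))\;\bigl|J_{(i,f^*)}(\mathbf{u})\bigr|\;\sqrt{1-u_1^2-u_2^2},\qquad \mathbf{u}=(u_1,u_2,u_3)\in f(\mathbb{D}_i),\quad i=1,\dots,n,$$ where, with $\tilde g_i$ and its partial derivatives evaluated at the first two coordinates $(x,y)$ of $\mathbf{x}=(x,y,z)\in\mathbb{D}_i$, $$l_i(\mathbf{x})=\Bigl[1+\Bigl(\frac{\partial\tilde g_i}{\partial x}\Bigr)^2+\Bigl(\frac{\partial\tilde g_i}{\partial y}\Bigr)^2\Bigr]^{1/2},\qquad J_{(i,f^*)}(\mathbf{u})=\frac{1}{J_{(i,f^{*-1})}(f^{-1}(\mathbf{u}))},$$ $$J_{(i,f^{*-1})}(\mathbf{x})=\frac{1}{(x^2+y^2+\tilde g_i^2)^3}\det\begin{pmatrix} y^2+\tilde g_i^2-x\tilde g_i\frac{\partial\tilde g_i}{\partial x} & -x\bigl(y+\tilde g_i\frac{\partial\tilde g_i}{\partial y}\bigr)\\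 -y\bigl(x+\tilde g_i\frac{\partial\tilde g_i}{\partial x}\bigr) & x^2+\tilde g_i^2-y\tilde g_i\frac{\partial\tilde g_i}{\partial y}\end{pmatrix}.$$ On the $\lambda$-null set of points where $J_{(i,f^{*-1})}$ vanishes or a partial derivative fails to exist, $\rho^*$ may take any nonnegative value. -/

import Mathlib

open MeasureTheory ProbabilityTheory Set Function
open scoped MeasureTheory

noncomputable section

/-- Euclidean three-space. -/
abbrev E3 : Type := EuclideanSpace ℝ (Fin 3)

/-- The mean measure `μ(B) = ∫_B ρ dλ_S` (for `B ⊆ S`) of an intensity function `ρ`. The surface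
area measure is the two-dimensional Hausdorff measure `μHE[2]`, normalised so as to agree with
Lebesgue measure on planes. -/
def meanMeasure (ρ : E3 → ℝ) (B : Set E3) : ENNReal :=
  ∫⁻ x in B, ENNReal.ofReal (ρ x) ∂(μHE[2] : Measure E3)

/-- A (simple, locally finite) point process on the surface `S`: a random locally finite
subset of `S` all of whose counting variables are measurable. -/
structure IsPointProcess {Ω : Type*} [MeasurableSpace Ω] (S : Set E3) (X : Ω → Set E3) :
    Prop where
  subset : ∀ ω, X ω ⊆ S
  locallyFinite : ∀ ω, ∀ B : Set E3, Bornology.IsBounded B → (X ω ∩ B).Finite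
  measurable_count : ∀ B : Set E3, MeasurableSet B → B ⊆ S →
    Measurable fun ω => (X ω ∩ B).encard

/-- `X` is a Poisson process on the surface `S` with intensity function `ρ` with respect to
surface area: `ρ` is nonnegative and locally integrable on `S`, the number of points in every
Borel set `B ⊆ S` with `μ(B) < ∞` is Poisson distributed with mean `μ(B)`, and the numbers of
points in disjoint Borel sets are independent. -/
structure IsPoissonProcess {Ω : Type*} [MeasurableSpace Ω] (P : Measure Ω) (S : Set E3)
    (ρ : E3 → ℝ) (X : Ω → Set E3) : Prop extends IsPointProcess S X where
  intensity_nonneg : ∀ x ∈ S, 0 ≤ ρ x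
  intensity_integrable : ∀ B : Set E3, MeasurableSet B → B ⊆ S → Bornology.IsBounded B →
    IntegrableOn ρ B (μHE[2] : Measure E3)
  count_law : ∀ B : Set E3, MeasurableSet B → B ⊆ S → meanMeasure ρ B < ⊤ →
    HasLaw (fun ω => (X ω ∩ B).encard)
      ((poissonMeasure (meanMeasure ρ B).toNNReal).map (fun k : ℕ => (k : ℕ∞))) P
  count_indep : ∀ (k : ℕ) (B : Fin k → Set E3), (∀ j, MeasurableSet (B j)) →
    (∀ j, B j ⊆ S) → Pairwise (Disjoint on B) →
    iIndepFun (fun (j : Fin k) (ω : Ω) => (X ω ∩ B j).encard) P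

/-- The radial projection `f(x) = x / ‖x‖`. -/
def radialProj (x : E3) : E3 := ‖x‖⁻¹ • x

/-- The partial derivative `∂h/∂x` at `(x, y)`. -/
def partialX (h : ℝ → ℝ → ℝ) (x y : ℝ) : ℝ := deriv (fun t => h t y) x

/-- The partial derivative `∂h/∂y` at `(x, y)`. -/
def partialY (h : ℝ → ℝ → ℝ) (x y : ℝ) : ℝ := deriv (fun t => h x t) y

/-- The area factor `l = √(1 + (∂h/∂x)² + (∂h/∂y)²)` of the graph `z = h(x, y)`. -/
def areaFactor (h : ℝ → ℝ → ℝ) (p : E3) : ℝ :=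
  Real.sqrt (1 + (partialX h (p 0) (p 1)) ^ 2 + (partialY h (p 0) (p 1)) ^ 2)

/-- The determinant of the derivative of `(x, y) ↦ (x / r, y / r)`, `r = √(x² + y² + h(x, y)²)`,
at the first two coordinates of `p`, in explicit form. -/
def planarJacobian (h : ℝ → ℝ → ℝ) (p : E3) : ℝ :=
  let x := p 0
  let y := p 1
  let z := h x y
  let zx := partialX h x y
  let zy := partialY h x y
  1 / (x ^ 2 + y ^ 2 + z ^ 2) ^ 3 *
    Matrix.det !![y ^ 2 + z ^ 2 - x * z * zx, -x * (y + z * zy);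
                  -y * (x + z * zx), x ^ 2 + z ^ 2 - y * z * zy]

/-- The transformed intensity on the image of the piece `z = h(x, y)` of the surface `D`:
`ρ(f⁻¹(u)) · l(f⁻¹(u)) · |1 / J(f⁻¹(u))| · √(1 - u₁² - u₂²)`, where `f⁻¹` is the inverse of the
radial projection on `D`. -/
def pieceIntensity (D : Set E3) (ρ : E3 → ℝ) (h : ℝ → ℝ → ℝ) (u : E3) : ℝ :=
  let p := invFunOn radialProj D u
  ρ p * areaFactor h p * |1 / planarJacobian h p| * Real.sqrt (1 - (u 0) ^ 2 - (u 1) ^ 2)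

end

/-!
The boundary `D` of a bounded convex body `K` with the origin in its interior is met exactly once by
each ray from the origin, at the point `(gauge K u)⁻¹ • u` of the ray through `u`. Hence the radial
projection `f : D → 𝕊²` is a bijection, and both it and its inverse are Lipschitz; in particular
`f` and `f⁻¹` preserve sets of area zero. An injective Borel map carries a Poisson process to a
Poisson process (`IsPoissonProcess.image`), so what has to be shown is that the stated intensity
`ρ*` has mean measure `∫_C ρ* dλ = ∫_{f⁻¹(C)} ρ dλ`.

The two sides are compared in planar coordinates. The tool is the area formula for a graph
`z = H(x, y)` (`setLIntegral_image_graphMap`): the area of the graph over a Borel set `s` is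
`∫_s √(1 + H_x² + H_y²)`, if `H` is differentiable on `s`. It is proved by cutting `s` into
countably many pieces on which `H` is close to a linear function, where the graph is bi-Lipschitz equivalent,
with constant close to one, to a plane. The formula applies to a piece of `D` and also to its radial
image, which off the equator is contained in the two graphs `±√(1 - |v|²)`, of area density
`1 / √(1 - |v|²)`. The radial projection induces between the parameter domains the planar map
`(x, y) ↦ (x / r, y / r)`, with Jacobian determinant `J`, and the planar change of variables formula
gives `λ(f(B)) = ∫_s |J| / √(1 - |v|²)`. Comparing with `λ(B) = ∫_s l` yields the factor
`l · |1 / J| · √(1 - u₁² - u₂²)` (`setLIntegral_radialProj_image`).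

Three sets have to be discarded. The points where `H` is not differentiable are a null set by
hypothesis, so their image is one. The equator `z = 0` of the sphere and the image of the zero set
of `J` (off the equator) are null, so their preimages in `D` are.
-/

open Filter Topology ENNReal NNReal

/-! ### Graphs over the plane and their area density -/

/-- The Euclidean plane, the parameter domain of graphs in `E3`. -/
abbrev E2 : Type := EuclideanSpace ℝ (Fin 2)

/-- The parametrization `(x, y) ↦ (x, y, H (x, y))` of the graph of `H`. -/
noncomputable def graphMap (H : E2 → ℝ) (q : E2) : E3 := !₂[q 0, q 1, H q]

/-- The orthogonal projection of space onto the first two coordinates. -/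
noncomputable def planeProj (p : E3) : E2 := !₂[p 0, p 1]

/-- The area density `√(1 + a₀² + a₁²)` of a graph whose defining function has derivative `a`,
where `a₀` and `a₁` are the values of `a` on the standard basis. -/
noncomputable def slopeDensity (a : E2 →L[ℝ] ℝ) : ℝ :=
  √(1 + a (EuclideanSpace.single 0 1) ^ 2 + a (EuclideanSpace.single 1 1) ^ 2)

@[simp] lemma graphMap_zero (H : E2 → ℝ) (q : E2) : graphMap H q 0 = q 0 := rfl
@[simp] lemma graphMap_one (H : E2 → ℝ) (q : E2) : graphMap H q 1 = q 1 := rfl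
@[simp] lemma graphMap_two (H : E2 → ℝ) (q : E2) : graphMap H q 2 = H q := rfl
@[simp] lemma planeProj_zero (p : E3) : planeProj p 0 = p 0 := rfl
@[simp] lemma planeProj_one (p : E3) : planeProj p 1 = p 1 := rfl

@[simp] lemma planeProj_graphMap (H : E2 → ℝ) (q : E2) : planeProj (graphMap H q) = q := by
  ext i; fin_cases i <;> rfl

lemma graphMap_injective (H : E2 → ℝ) : Injective (graphMap H) :=
  LeftInverse.injective (planeProj_graphMap H)

lemma graphMap_planeProj {H : E2 → ℝ} {p : E3} (hp : p 2 = H (planeProj p)) :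
    graphMap H (planeProj p) = p := by
  ext i; fin_cases i
  · rfl
  · rfl
  · exact hp.symm

lemma continuous_planeProj : Continuous planeProj := by
  unfold planeProj
  fun_prop

lemma norm_sq_graphMap_sub (H G : E2 → ℝ) (x y : E2) :
    ‖graphMap H x - graphMap G y‖ ^ 2 = ‖x - y‖ ^ 2 + (H x - G y) ^ 2 := by
  rw [EuclideanSpace.norm_sq_eq, EuclideanSpace.norm_sq_eq, Fin.sum_univ_three, Fin.sum_univ_two]
  simp

lemma norm_sub_le_norm_graphMap_sub (H : E2 → ℝ) (x y : E2) :
    ‖x - y‖ ≤ ‖graphMap H x - graphMap H y‖ := by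
  refine le_of_sq_le_sq ?_ (norm_nonneg _)
  rw [norm_sq_graphMap_sub]
  nlinarith [sq_nonneg (H x - H y)]

/-- Two graphs over the same set are bi-Lipschitz equivalent, with constant close to one, when
the difference of the two functions has a small Lipschitz constant. -/
lemma dist_graphMap_le {H G : E2 → ℝ} {δ : ℝ} {x y : E2}
    (h : |(H x - H y) - (G x - G y)| ≤ δ * ‖x - y‖) (hδ : 0 ≤ δ) :
    dist (graphMap H x) (graphMap H y) ≤ (1 + δ) * dist (graphMap G x) (graphMap G y) := by
  rw [dist_eq_norm, dist_eq_norm]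
  have hdiff : ‖(graphMap H x - graphMap H y) - (graphMap G x - graphMap G y)‖
      = |(H x - H y) - (G x - G y)| := by
    rw [EuclideanSpace.norm_eq, Fin.sum_univ_three, ← Real.sqrt_sq_eq_abs]
    simp
  calc ‖graphMap H x - graphMap H y‖
      = ‖(graphMap G x - graphMap G y)
          + ((graphMap H x - graphMap H y) - (graphMap G x - graphMap G y))‖ := by
        congr 1; abel
    _ ≤ ‖graphMap G x - graphMap G y‖ + δ * ‖x - y‖ := by
        refine (norm_add_le _ _).trans ?_
        rw [hdiff]; gcongr
    _ ≤ ‖graphMap G x - graphMap G y‖ + δ * ‖graphMap G x - graphMap G y‖ := by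
        gcongr; exact norm_sub_le_norm_graphMap_sub G x y
    _ = _ := by ring

/-- The linear parametrization of the plane through the origin with slope `a`. -/
noncomputable def graphLinear (a : E2 →L[ℝ] ℝ) : E2 →ₗ[ℝ] E3 where
  toFun := graphMap a
  map_add' x y := by
    ext i; fin_cases i <;> simp [graphMap]
  map_smul' c x := by
    ext i; fin_cases i <;> simp [graphMap]

/-- The Gram determinant of the images of the basis vectors is `1 + a₀² + a₁²`. -/
lemma normDet_graphLinear (a : E2 →L[ℝ] ℝ) : (graphLinear a).normDet = slopeDensity a := by
  rw [slopeDensity, eq_comm, Real.sqrt_eq_iff_mul_self_eq (by positivity)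
    (LinearMap.normDet_nonneg _), ← sq]
  have h := LinearMap.normDet_sq_eq_det_gram (graphLinear a) (EuclideanSpace.basisFun (Fin 2) ℝ)
  simp only [RCLike.ofReal_real_eq_id, id] at h
  rw [h, Matrix.det_fin_two]
  simp [Matrix.gram, graphLinear, graphMap, PiLp.inner_apply, Fin.sum_univ_three]
  ring

lemma hausdorff_image_graphMap_linear (a : E2 →L[ℝ] ℝ) (B : Set E2) :
    (μHE[2] : Measure E3) (graphMap a '' B) = ENNReal.ofReal (slopeDensity a) * volume B := by
  have h := LinearMap.euclideanHausdorffMeasure_image_eq_normDet_mul_volume (graphLinear a) B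
  rw [normDet_graphLinear, finrank_euclideanSpace_fin] at h
  exact h

lemma one_le_slopeDensity (a : E2 →L[ℝ] ℝ) : 1 ≤ slopeDensity a := by
  rw [slopeDensity, Real.one_le_sqrt]
  nlinarith [sq_nonneg (a (EuclideanSpace.single 0 1)), sq_nonneg (a (EuclideanSpace.single 1 1))]

lemma slopeDensity_le {a b : E2 →L[ℝ] ℝ} {δ : ℝ} (h : ‖a - b‖ ≤ δ) :
    slopeDensity a ≤ (1 + 2 * δ) * slopeDensity b := by
  have hδ : 0 ≤ δ := (norm_nonneg _).trans h
  have key (i : Fin 2) : |a (EuclideanSpace.single i 1) - b (EuclideanSpace.single i 1)| ≤ δ := by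
    have := (a - b).le_opNorm (EuclideanSpace.single i 1)
    simp only [PiLp.norm_single, norm_one, mul_one] at this
    exact this.trans h
  -- `slopeDensity a` is the norm of the vector `(1, a₀, a₁)`.
  have hn (c : E2 →L[ℝ] ℝ) : slopeDensity c =
      ‖graphMap (fun _ ↦ 1) !₂[c (EuclideanSpace.single 0 1), c (EuclideanSpace.single 1 1)]‖ := by
    rw [EuclideanSpace.norm_eq, Fin.sum_univ_three, slopeDensity]
    congr 1
    simp
    ring
  have hs : slopeDensity a ≤ slopeDensity b + 2 * δ := by
    rw [hn a, hn b]
    refine (norm_le_insert' _ _).trans (add_le_add_right ?_ _)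
    refine le_of_sq_le_sq ?_ (by positivity)
    rw [norm_sq_graphMap_sub, EuclideanSpace.norm_sq_eq, Fin.sum_univ_two]
    simp only [PiLp.sub_apply, Real.norm_eq_abs, sub_self]
    have h0 := pow_le_pow_left₀ (abs_nonneg _) (key 0) 2
    have h1 := pow_le_pow_left₀ (abs_nonneg _) (key 1) 2
    simp at h0 h1 ⊢
    nlinarith
  nlinarith [one_le_slopeDensity b]

/-- A map which is expanded at most by the factor `C` compared with another one has image of
area at most `C²` times that of the other. -/
lemma hausdorff_image_le_of_dist_le {X Y Z : Type*} [MetricSpace Y] [MeasurableSpace Y]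
    [BorelSpace Y] [MetricSpace Z] [MeasurableSpace Z] [BorelSpace Z] {f : X → Y} {g : X → Z}
    {B : Set X} {C : ℝ≥0}
    (h : ∀ x ∈ B, ∀ y ∈ B, dist (g x) (g y) ≤ C * dist (f x) (f y)) :
    (μHE[2] : Measure Z) (g '' B) ≤ (C : ℝ≥0∞) ^ 2 * (μHE[2] : Measure Y) (f '' B) := by
  classical
  rcases B.eq_empty_or_nonempty with rfl | ⟨x₀, -⟩
  · simp
  have : Nonempty X := ⟨x₀⟩
  have hlip : LipschitzOnWith C (g ∘ invFunOn f B) (f '' B) := by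
    refine LipschitzOnWith.of_dist_le_mul fun y hy z hz ↦ ?_
    have := h _ (invFunOn_mem hy) _ (invFunOn_mem hz)
    rwa [invFunOn_eq hy, invFunOn_eq hz] at this
  have himg : g '' B ⊆ (g ∘ invFunOn f B) '' (f '' B) := by
    rintro _ ⟨x, hx, rfl⟩
    refine ⟨f x, mem_image_of_mem f hx, ?_⟩
    have hm : f x ∈ f '' B := mem_image_of_mem f hx
    refine dist_le_zero.1 ?_
    refine (h _ (invFunOn_mem hm) _ hx).trans ?_
    rw [invFunOn_eq hm, dist_self, mul_zero]
  refine (measure_mono himg).trans ?_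
  have := hlip.hausdorffMeasure_image_le (d := 2) (by norm_num)
  simp only [Measure.euclideanHausdorffMeasure_def, Measure.smul_apply, Nat.cast_ofNat]
  rw [mul_smul_comm]
  gcongr
  simpa using this

/-- A linear approximation of a function on a set is close to the derivative of the function at
almost every point of the set. -/
lemma ApproximatesLinearOn.norm_fderiv_sub_le_of_real {H : E2 → ℝ} {A : E2 →L[ℝ] ℝ} {s : Set E2}
    {δ : ℝ≥0} (hf : ApproximatesLinearOn H A s δ) (hs : MeasurableSet s)
    (H' : E2 → E2 →L[ℝ] ℝ) (hH' : ∀ x ∈ s, HasFDerivWithinAt H (H' x) s x) :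
    ∀ᵐ x ∂volume.restrict s, ‖H' x - A‖ ≤ δ := by
  -- The available statement concerns self-maps, so real values are placed on a coordinate axis.
  set e : E2 := EuclideanSpace.single 0 1 with he
  have hen : ‖e‖ = 1 := by simp [he]
  have h1 : ApproximatesLinearOn (fun x ↦ H x • e) (A.smulRight e) s δ := by
    intro x hx y hy
    have := hf x hx y hy
    rw [ContinuousLinearMap.smulRight_apply, ← sub_smul, ← sub_smul, norm_smul, hen, mul_one]
    exact this
  have h2 := h1.norm_fderiv_sub_le volume hs (fun x ↦ (H' x).smulRight e)
    (fun x hx ↦ (hH' x hx).smul_const e)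
  filter_upwards [h2] with x hx
  have : (H' x).smulRight e - A.smulRight e = (H' x - A).smulRight e := by
    ext v; simp [sub_mul]
  rw [this] at hx
  have h3 := NNReal.coe_le_coe.2 hx
  rwa [coe_nnnorm, ContinuousLinearMap.norm_smulRight_apply, hen, mul_one] at h3

/-- An inequality up to constants arbitrarily close to one is exact. The bound `3 / 2` leaves room
for estimates that hold for small deviations only. -/
lemma ENNReal.le_of_forall_one_lt_pow_three {a b : ℝ≥0∞}
    (h : ∀ k : ℝ≥0, 1 < k → k < 3 / 2 → a ≤ (k : ℝ≥0∞) ^ 3 * b) : a ≤ b := by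
  have hlim : Tendsto (fun k : ℝ≥0 ↦ (k : ℝ≥0∞) ^ 3 * b) (𝓝[>] 1) (𝓝 ((1 : ℝ≥0∞) ^ 3 * b)) := by
    refine ENNReal.Tendsto.mul_const ?_ (Or.inl (by simp))
    have : Tendsto (fun k : ℝ≥0 ↦ (k : ℝ≥0∞)) (𝓝[>] 1) (𝓝 1) := by
      exact (ENNReal.continuous_coe.tendsto 1).mono_left nhdsWithin_le_nhds
    exact ((ENNReal.continuous_pow 3).tendsto 1).comp this
  rw [one_pow, one_mul] at hlim
  refine ge_of_tendsto hlim ?_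
  have h32 : Iio (3 / 2 : ℝ≥0) ∈ 𝓝[>] (1 : ℝ≥0) :=
    nhdsWithin_le_nhds (Iio_mem_nhds (by rw [lt_div_iff₀] <;> norm_num))
  filter_upwards [self_mem_nhdsWithin, h32] with k hk hk'
  exact h k hk hk'

/-! ### The area formula for graphs -/

section GraphArea

variable {H : E2 → ℝ} {H' : E2 → E2 →L[ℝ] ℝ} {s : Set E2}

lemma continuousOn_graphMap (hH' : ∀ x ∈ s, HasFDerivWithinAt H (H' x) s x) :
    ContinuousOn (graphMap H) s := by
  have hH : ContinuousOn H s := fun x hx ↦ (hH' x hx).continuousWithinAt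
  refine (PiLp.continuous_toLp 2 _).comp_continuousOn (continuousOn_pi.2 fun i ↦ ?_)
  fin_cases i
  · exact (PiLp.continuous_apply 2 _ 0).continuousOn
  · exact (PiLp.continuous_apply 2 _ 1).continuousOn
  · exact hH

lemma measurableEmbedding_graphMap (hs : MeasurableSet s)
    (hH' : ∀ x ∈ s, HasFDerivWithinAt H (H' x) s x) :
    MeasurableEmbedding (s.domRestrict (graphMap H)) :=
  (continuousOn_graphMap hH').measurableEmbedding hs (graphMap_injective H).injOn

lemma measurableSet_image_graphMap (hs : MeasurableSet s)
    (hH' : ∀ x ∈ s, HasFDerivWithinAt H (H' x) s x) : MeasurableSet (graphMap H '' s) :=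
  hs.image_of_continuousOn_injOn (continuousOn_graphMap hH') (graphMap_injective H).injOn

/-- The area formula up to constants on a set where the function is close to a linear one. Of the
three factors `1 + 2 * δ`, two account for the comparison of the areas of the graph and of the
plane, and one for the comparison of their area densities. -/
lemma hausdorff_image_graphMap_bounds_of_approximatesLinearOn (hs : MeasurableSet s)
    (hH' : ∀ x ∈ s, HasFDerivWithinAt H (H' x) s x) {A : E2 →L[ℝ] ℝ} {δ : ℝ≥0}
    (hδ : δ ≤ 1 / 4) (hA : ApproximatesLinearOn H A s δ) :
    (μHE[2] : Measure E3) (graphMap H '' s) ≤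
        ((1 + 2 * δ : ℝ≥0) : ℝ≥0∞) ^ 3 * ∫⁻ x in s, ENNReal.ofReal (slopeDensity (H' x)) ∧
      ∫⁻ x in s, ENNReal.ofReal (slopeDensity (H' x)) ≤
        ((1 + 2 * δ : ℝ≥0) : ℝ≥0∞) ^ 3 * (μHE[2] : Measure E3) (graphMap H '' s) := by
  have hδ' : (δ : ℝ) ≤ 1 / 4 := by exact_mod_cast hδ
  have happ (x) (hx : x ∈ s) (y) (hy : y ∈ s) : |(H x - H y) - (A x - A y)| ≤ δ * ‖x - y‖ := by
    have := hA x hx y hy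
    rwa [map_sub, Real.norm_eq_abs] at this
  have hk (c : ℝ) : ENNReal.ofReal ((1 + 2 * δ) * c)
      = ((1 + 2 * δ : ℝ≥0) : ℝ≥0∞) * ENNReal.ofReal c := by
    rw [ENNReal.ofReal_mul (by positivity), ← ENNReal.ofReal_coe_nnreal]
    simp
  have hae := hA.norm_fderiv_sub_le_of_real hs H' hH'
  set k : ℝ≥0 := 1 + 2 * δ with hkdef
  constructor
  · have h1 : (μHE[2] : Measure E3) (graphMap H '' s)
        ≤ (k : ℝ≥0∞) ^ 2 * (μHE[2] : Measure E3) (graphMap A '' s) := by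
      refine hausdorff_image_le_of_dist_le fun x hx y hy ↦ ?_
      refine (dist_graphMap_le (happ x hx y hy) δ.2).trans ?_
      gcongr
      rw [hkdef]; push_cast
      linarith [δ.coe_nonneg]
    rw [hausdorff_image_graphMap_linear, ← setLIntegral_const] at h1
    have h2 : ∫⁻ _ in s, ENNReal.ofReal (slopeDensity A)
        ≤ ∫⁻ x in s, (k : ℝ≥0∞) * ENNReal.ofReal (slopeDensity (H' x)) := by
      refine lintegral_mono_ae ?_
      filter_upwards [hae] with x hx
      rw [← hk]
      refine ENNReal.ofReal_le_ofReal (slopeDensity_le ?_)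
      rwa [norm_sub_rev]
    rw [lintegral_const_mul' _ _ ENNReal.coe_ne_top] at h2
    calc _ ≤ _ := h1
      _ ≤ (k : ℝ≥0∞) ^ 2 * _ := mul_le_mul_right h2 _
      _ = _ := by ring
  · have h1 : (μHE[2] : Measure E3) (graphMap A '' s)
        ≤ (k : ℝ≥0∞) ^ 2 * (μHE[2] : Measure E3) (graphMap H '' s) := by
      refine hausdorff_image_le_of_dist_le fun x hx y hy ↦ ?_
      have h3 : ‖x - y‖ ≤ dist (graphMap H x) (graphMap H y) := by
        rw [dist_eq_norm]; exact norm_sub_le_norm_graphMap_sub H x y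
      refine (dist_graphMap_le (G := H) (δ := δ) ?_ δ.2).trans ?_
      · rw [abs_sub_comm]; exact happ x hx y hy
      gcongr
      rw [hkdef]; push_cast
      linarith [δ.coe_nonneg]
    rw [hausdorff_image_graphMap_linear, ← setLIntegral_const] at h1
    have h2 : ∫⁻ x in s, ENNReal.ofReal (slopeDensity (H' x))
        ≤ ∫⁻ _ in s, (k : ℝ≥0∞) * ENNReal.ofReal (slopeDensity A) := by
      refine lintegral_mono_ae ?_
      filter_upwards [hae] with x hx
      rw [← hk]
      exact ENNReal.ofReal_le_ofReal (slopeDensity_le hx)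
    rw [lintegral_const_mul' _ _ ENNReal.coe_ne_top] at h2
    calc _ ≤ _ := h2
      _ ≤ (k : ℝ≥0∞) * _ := mul_le_mul_right h1 _
      _ = _ := by ring

/-- The area formula for graphs, for the two-dimensional Hausdorff measure. -/
theorem hausdorff_image_graphMap (hs : MeasurableSet s)
    (hH' : ∀ x ∈ s, HasFDerivWithinAt H (H' x) s x) :
    (μHE[2] : Measure E3) (graphMap H '' s) =
      ∫⁻ x in s, ENNReal.ofReal (slopeDensity (H' x)) := by
  have key (k : ℝ≥0) (hk : 1 < k) (hk' : k < 3 / 2) :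
      (μHE[2] : Measure E3) (graphMap H '' s) ≤
          (k : ℝ≥0∞) ^ 3 * ∫⁻ x in s, ENNReal.ofReal (slopeDensity (H' x)) ∧
        ∫⁻ x in s, ENNReal.ofReal (slopeDensity (H' x)) ≤
          (k : ℝ≥0∞) ^ 3 * (μHE[2] : Measure E3) (graphMap H '' s) := by
    obtain ⟨δ, rfl⟩ : ∃ δ : ℝ≥0, 1 + 2 * δ = k := by
      refine ⟨(k - 1) / 2, ?_⟩
      rw [mul_div_cancel₀ _ two_ne_zero, add_tsub_cancel_of_le hk.le]
    have hδ0 : δ ≠ 0 := by rintro rfl; simp at hk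
    have hδ : δ ≤ 1 / 4 := by
      rw [← NNReal.coe_lt_coe] at hk'
      rw [← NNReal.coe_le_coe]
      push_cast at hk' ⊢
      linarith
    obtain ⟨t, A, hdisj, htm, hst, happ, -⟩ :=
      exists_partition_approximatesLinearOn_of_hasFDerivWithinAt H s H' hH' (fun _ ↦ δ)
        (fun _ ↦ hδ0)
    have hcov : s = ⋃ n, s ∩ t n := by rw [← inter_iUnion, inter_eq_left.2 hst]
    have hm (n) : MeasurableSet (s ∩ t n) := hs.inter (htm n)
    have hH'n (n) : ∀ x ∈ s ∩ t n, HasFDerivWithinAt H (H' x) (s ∩ t n) x :=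
      fun x hx ↦ (hH' x hx.1).mono inter_subset_left
    have hd : Pairwise (Disjoint on fun n ↦ s ∩ t n) :=
      fun i j hij ↦ (hdisj hij).mono inter_subset_right inter_subset_right
    have e1 : (μHE[2] : Measure E3) (graphMap H '' s)
        = ∑' n, (μHE[2] : Measure E3) (graphMap H '' (s ∩ t n)) := by
      conv_lhs => rw [hcov, image_iUnion]
      refine measure_iUnion (fun i j hij ↦ ?_) fun n ↦
        measurableSet_image_graphMap (hm n) (hH'n n)
      exact (disjoint_image_iff (graphMap_injective H)).2 (hd hij)
    have e2 : ∫⁻ x in s, ENNReal.ofReal (slopeDensity (H' x))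
        = ∑' n, ∫⁻ x in s ∩ t n, ENNReal.ofReal (slopeDensity (H' x)) := by
      conv_lhs => rw [hcov]
      exact lintegral_iUnion hm hd _
    rw [e1, e2, ← ENNReal.tsum_mul_left, ← ENNReal.tsum_mul_left]
    have hb (n) := hausdorff_image_graphMap_bounds_of_approximatesLinearOn (hm n) (hH'n n) hδ
      (happ n)
    exact ⟨ENNReal.tsum_le_tsum fun n ↦ (hb n).1, ENNReal.tsum_le_tsum fun n ↦ (hb n).2⟩
  exact le_antisymm
    (ENNReal.le_of_forall_one_lt_pow_three fun k hk hk' ↦ (key k hk hk').1)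
    (ENNReal.le_of_forall_one_lt_pow_three fun k hk hk' ↦ (key k hk hk').2)

lemma aemeasurable_slopeDensity (hs : MeasurableSet s)
    (hH' : ∀ x ∈ s, HasFDerivWithinAt H (H' x) s x) :
    AEMeasurable (fun x ↦ ENNReal.ofReal (slopeDensity (H' x))) (volume.restrict s) := by
  -- The available statement concerns self-maps, so real values are placed on a coordinate axis.
  set e : E2 := EuclideanSpace.single 0 1 with he
  have h := aemeasurable_fderivWithin volume hs (f := fun x ↦ H x • e)
    (f' := fun x ↦ (H' x).smulRight e) (fun x hx ↦ (hH' x hx).smul_const e)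
  have hc (i : Fin 2) : AEMeasurable (fun x ↦ H' x (EuclideanSpace.single i 1))
      (volume.restrict s) := by
    have h1 : Measurable fun a : E2 →L[ℝ] E2 ↦ a (EuclideanSpace.single i 1) 0 :=
      (PiLp.continuous_apply 2 (fun _ : Fin 2 ↦ ℝ) 0).measurable.comp
        (ContinuousLinearMap.measurable_apply _)
    refine (h1.comp_aemeasurable h).congr (Eventually.of_forall fun x ↦ ?_)
    simp [he]
  exact ((((hc 0).pow_const 2).const_add 1).add ((hc 1).pow_const 2)).sqrt.ennreal_ofReal

lemma map_withDensity_slopeDensity_eq_hausdorff (hs : MeasurableSet s)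
    (hH' : ∀ x ∈ s, HasFDerivWithinAt H (H' x) s x) :
    Measure.map (s.domRestrict (graphMap H)) (Measure.comap (↑)
        (volume.withDensity fun x ↦ ENNReal.ofReal (slopeDensity (H' x)))) =
      (μHE[2] : Measure E3).restrict (graphMap H '' s) := by
  have hemb := measurableEmbedding_graphMap hs hH'
  ext t ht
  have hpre : MeasurableSet (s.domRestrict (graphMap H) ⁻¹' t) := hemb.measurable ht
  have himg : ((↑) : s → E2) '' (s.domRestrict (graphMap H) ⁻¹' t) = s ∩ graphMap H ⁻¹' t := by
    ext x
    simp [and_comm]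
  have hm : MeasurableSet (s ∩ graphMap H ⁻¹' t) := by
    rw [← himg]
    exact (MeasurableEmbedding.subtype_coe hs).measurableSet_image.2 hpre
  rw [hemb.map_apply, (MeasurableEmbedding.subtype_coe hs).comap_apply, himg,
    withDensity_apply _ hm, Measure.restrict_apply ht, ← hausdorff_image_graphMap hm
      fun x hx ↦ (hH' x hx.1).mono inter_subset_left, inter_comm t, ← image_inter_preimage]

/-- The area formula for graphs, for the integral of an arbitrary (not necessarily measurable)
function over the graph. -/
theorem setLIntegral_image_graphMap (hs : MeasurableSet s)
    (hH' : ∀ x ∈ s, HasFDerivWithinAt H (H' x) s x) (F : E3 → ℝ≥0∞) :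
    ∫⁻ p in graphMap H '' s, F p ∂(μHE[2] : Measure E3) =
      ∫⁻ x in s, ENNReal.ofReal (slopeDensity (H' x)) * F (graphMap H x) := by
  rw [← map_withDensity_slopeDensity_eq_hausdorff hs hH',
    (measurableEmbedding_graphMap hs hH').lintegral_map]
  simp only [Set.domRestrict_apply, ← Function.comp_apply (f := F)]
  rw [← (MeasurableEmbedding.subtype_coe hs).lintegral_map, map_comap_subtype_coe hs,
    setLIntegral_withDensity_eq_setLIntegral_mul_non_measurable₀ _ _ _ hs]
  · simp only [Pi.mul_apply]
  · simp only [eventually_true, ENNReal.ofReal_lt_top]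
  · exact aemeasurable_slopeDensity hs hH'

end GraphArea

/-! ### The radial projection of the boundary of a convex body -/

section RadialProjection

/-- The radial map inverting `radialProj` on the boundary of the convex body `K`; the gauge of `K`
is the Minkowski functional, equal to one exactly on the boundary. -/
noncomputable def radialInv (K : Set E3) (u : E3) : E3 := (gauge K u)⁻¹ • u

lemma LipschitzOnWith.hausdorff_image_eq_zero {X Y : Type*} [MetricSpace X] [MeasurableSpace X]
    [BorelSpace X] [MetricSpace Y] [MeasurableSpace Y] [BorelSpace Y] {f : X → Y} {s : Set X}
    {C : ℝ≥0} (hf : LipschitzOnWith C f s) (hs : (μHE[2] : Measure X) s = 0) :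
    (μHE[2] : Measure Y) (f '' s) = 0 := by
  have h := hausdorff_image_le_of_dist_le (f := id) (g := f) (B := s) (C := C)
    fun x hx y hy ↦ hf.dist_le_mul x hx y hy
  rw [image_id, hs, mul_zero] at h
  exact le_antisymm h zero_le

lemma measurable_radialProj : Measurable radialProj := by
  unfold radialProj
  fun_prop

lemma norm_radialProj {x : E3} (hx : x ≠ 0) : ‖radialProj x‖ = 1 := by
  rw [radialProj, norm_smul, norm_inv, norm_norm, inv_mul_cancel₀ (norm_ne_zero_iff.2 hx)]

lemma norm_inv_smul_sub_le {c d r : ℝ} {x y : E3} (hr : 0 < r) (hc : r ≤ c) (hd : 0 < d) :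
    ‖c⁻¹ • x - d⁻¹ • y‖ ≤ r⁻¹ * (‖x - y‖ + |c - d| * (‖y‖ / d)) := by
  have hc0 : 0 < c := hr.trans_le hc
  have h1 : c⁻¹ • x - d⁻¹ • y = c⁻¹ • ((x - y) + ((d - c) / d) • y) := by
    rw [smul_add, smul_sub, smul_smul, sub_add, ← sub_smul]
    congr 2
    field_simp
    ring
  rw [h1, norm_smul, norm_inv, Real.norm_of_nonneg hc0.le]
  gcongr
  refine (norm_add_le _ _).trans ?_
  rw [norm_smul, norm_div, Real.norm_of_nonneg hd.le, Real.norm_eq_abs, abs_sub_comm,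
    div_mul_eq_mul_div, mul_div_assoc]

lemma lipschitzOnWith_radialProj {s : Set E3} {r : ℝ≥0} (hr : 0 < r) (hs : ∀ x ∈ s, r ≤ ‖x‖) :
    LipschitzOnWith (r⁻¹ * 2) radialProj s := by
  refine LipschitzOnWith.of_dist_le_mul fun x hx y hy ↦ ?_
  have hr' : (0 : ℝ) < r := hr
  have hy0 : 0 < ‖y‖ := hr'.trans_le (hs y hy)
  rw [dist_eq_norm, dist_eq_norm]
  refine (norm_inv_smul_sub_le hr' (hs x hx) hy0).trans ?_
  rw [div_self hy0.ne', mul_one]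
  push_cast
  rw [mul_assoc]
  gcongr
  linarith [abs_norm_sub_norm_le x y]

variable {K : Set E3}

lemma exists_pos_le_norm_of_mem_frontier (hK0 : (0 : E3) ∈ interior K) :
    ∃ r : ℝ≥0, 0 < r ∧ ∀ x ∈ frontier K, r ≤ ‖x‖ := by
  obtain ⟨r, hr, hball⟩ := Metric.isOpen_iff.1 isOpen_interior _ hK0
  refine ⟨⟨r, hr.le⟩, hr, fun x hx ↦ ?_⟩
  by_contra! h
  exact hx.2 (hball (mem_ball_zero_iff.2 h))

lemma ne_zero_of_mem_frontier (hK0 : (0 : E3) ∈ interior K) {x : E3} (hx : x ∈ frontier K) :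
    x ≠ 0 := by
  rintro rfl
  exact hx.2 hK0

lemma gauge_pos_of_isBounded (hKb : Bornology.IsBounded K) (hK0 : (0 : E3) ∈ interior K) {x : E3}
    (hx : x ≠ 0) : 0 < gauge K x :=
  (gauge_pos (absorbent_nhds_zero (mem_interior_iff_mem_nhds.1 hK0))
    ((NormedSpace.isVonNBounded_iff ℝ).2 hKb)).2 hx

lemma radialInv_mem_frontier (hK : Convex ℝ K) (hKb : Bornology.IsBounded K)
    (hK0 : (0 : E3) ∈ interior K) {u : E3} (hu : u ≠ 0) : radialInv K u ∈ frontier K := by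
  have hpos := gauge_pos_of_isBounded hKb hK0 hu
  rw [← gauge_eq_one_iff_mem_frontier hK (mem_interior_iff_mem_nhds.1 hK0), radialInv,
    gauge_smul_of_nonneg (inv_nonneg.2 hpos.le), smul_eq_mul, inv_mul_cancel₀ hpos.ne']

lemma radialProj_smul_of_norm_eq_one {c : ℝ} (hc : 0 < c) {u : E3} (hu : ‖u‖ = 1) :
    radialProj (c • u) = u := by
  rw [radialProj, norm_smul, hu, mul_one, Real.norm_of_nonneg hc.le, inv_smul_smul₀ hc.ne']

lemma radialProj_radialInv (hKb : Bornology.IsBounded K) (hK0 : (0 : E3) ∈ interior K) {u : E3}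
    (hu : ‖u‖ = 1) : radialProj (radialInv K u) = u :=
  radialProj_smul_of_norm_eq_one
    (inv_pos.2 (gauge_pos_of_isBounded hKb hK0 (norm_ne_zero_iff.1 (by simp [hu])))) hu

lemma radialInv_radialProj (hK : Convex ℝ K) (hK0 : (0 : E3) ∈ interior K) {x : E3}
    (hx : x ∈ frontier K) : radialInv K (radialProj x) = x := by
  have hg : gauge K x = 1 :=
    (gauge_eq_one_iff_mem_frontier hK (mem_interior_iff_mem_nhds.1 hK0)).2 hx
  have hn : 0 < ‖x‖ := norm_pos_iff.2 (ne_zero_of_mem_frontier hK0 hx)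
  rw [radialInv, radialProj, gauge_smul_of_nonneg (inv_nonneg.2 hn.le), hg, smul_eq_mul, mul_one,
    inv_inv, smul_inv_smul₀ hn.ne']

lemma injOn_radialProj_frontier (hK : Convex ℝ K) (hK0 : (0 : E3) ∈ interior K) :
    InjOn radialProj (frontier K) :=
  LeftInvOn.injOn fun _ hx ↦ radialInv_radialProj hK hK0 hx

theorem bijOn_radialProj_frontier (hK : Convex ℝ K) (hKb : Bornology.IsBounded K)
    (hK0 : (0 : E3) ∈ interior K) : BijOn radialProj (frontier K) (Metric.sphere 0 1) := by
  refine ⟨fun x hx ↦ ?_, injOn_radialProj_frontier hK hK0, fun u hu ↦ ?_⟩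
  · exact mem_sphere_zero_iff_norm.2 (norm_radialProj (ne_zero_of_mem_frontier hK0 hx))
  · have hu1 : ‖u‖ = 1 := mem_sphere_zero_iff_norm.1 hu
    exact ⟨radialInv K u,
      radialInv_mem_frontier hK hKb hK0 (norm_ne_zero_iff.1 (by simp [hu1])),
      radialProj_radialInv hKb hK0 hu1⟩

lemma measurable_radialInv (hK : Convex ℝ K) (hK0 : (0 : E3) ∈ interior K) :
    Measurable (radialInv K) := by
  have h : Measurable (gauge K) :=
    (continuous_gauge hK (mem_interior_iff_mem_nhds.1 hK0)).measurable
  exact h.inv.smul measurable_id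

lemma exists_lipschitzOnWith_radialInv (hK : Convex ℝ K) (hKb : Bornology.IsBounded K)
    (hK0 : (0 : E3) ∈ interior K) :
    ∃ C, LipschitzOnWith C (radialInv K) (Metric.sphere 0 1) := by
  have hn := mem_interior_iff_mem_nhds.1 hK0
  obtain ⟨R, hR, hKR⟩ := hKb.subset_ball_lt 0 0
  have hle {u : E3} (hu : ‖u‖ = 1) : R⁻¹ ≤ gauge K u := by
    have := le_gauge_of_subset_closedBall (x := u) (absorbent_nhds_zero hn) hR.le
      (hKR.trans Metric.ball_subset_closedBall)
    rwa [hu, one_div] at this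
  obtain ⟨M, hM⟩ := hK.lipschitz_gauge hn
  refine ⟨(R * (1 + M * R)).toNNReal, LipschitzOnWith.of_dist_le_mul fun u hu v hv ↦ ?_⟩
  rw [mem_sphere_zero_iff_norm] at hu hv
  have hv0 : 0 < gauge K v := (inv_pos.2 hR).trans_le (hle hv)
  rw [Real.coe_toNNReal _ (by positivity), dist_eq_norm, dist_eq_norm]
  refine (norm_inv_smul_sub_le (inv_pos.2 hR) (hle hu) hv0).trans ?_
  have h1 : |gauge K u - gauge K v| ≤ M * ‖u - v‖ := by
    have := hM.dist_le_mul u v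
    rwa [Real.dist_eq, dist_eq_norm] at this
  have h2 : ‖v‖ / gauge K v ≤ R := by
    rw [hv, one_div]
    exact inv_le_of_inv_le₀ hR (hle hv)
  rw [inv_inv]
  calc R * (‖u - v‖ + |gauge K u - gauge K v| * (‖v‖ / gauge K v))
      ≤ R * (‖u - v‖ + M * ‖u - v‖ * R) := by gcongr
    _ = _ := by ring

/-- The radial projection of a null subset of the boundary is null. -/
lemma hausdorff_radialProj_image_eq_zero (hK0 : (0 : E3) ∈ interior K) {N : Set E3}
    (hN : N ⊆ frontier K) (h : (μHE[2] : Measure E3) N = 0) :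
    (μHE[2] : Measure E3) (radialProj '' N) = 0 := by
  obtain ⟨r, hr, hle⟩ := exists_pos_le_norm_of_mem_frontier hK0
  exact (lipschitzOnWith_radialProj hr fun x hx ↦ hle x (hN hx)).hausdorff_image_eq_zero h

/-- A subset of the boundary with null radial projection is null. -/
lemma hausdorff_eq_zero_of_radialProj_image (hK : Convex ℝ K) (hKb : Bornology.IsBounded K)
    (hK0 : (0 : E3) ∈ interior K) {N : Set E3} (hN : N ⊆ frontier K)
    (h : (μHE[2] : Measure E3) (radialProj '' N) = 0) : (μHE[2] : Measure E3) N = 0 := by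
  obtain ⟨C, hC⟩ := exists_lipschitzOnWith_radialInv hK hKb hK0
  have hsub : radialProj '' N ⊆ Metric.sphere 0 1 :=
    (bijOn_radialProj_frontier hK hKb hK0).mapsTo.mono_left hN |>.image_subset
  have h1 := (hC.mono hsub).hausdorff_image_eq_zero h
  have h2 : radialInv K '' (radialProj '' N) = N := by
    rw [← image_comp]
    exact (image_congr fun x hx ↦ radialInv_radialProj hK hK0 (hN hx)).trans (image_id' N)
  rwa [h2] at h1

end RadialProjection

/-! ### The radial projection in planar coordinates -/

section PlanarMap

/-- The Jacobian determinant of `(x, y) ↦ (x / r, y / r)`, with `r` the distance to the origin of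
the point `(x, y, H (x, y))`, as a function of that point `p` and of the derivative `a` of `H`. -/
noncomputable def radialJacobian (p : E3) (a : E2 →L[ℝ] ℝ) : ℝ :=
  1 / (p 0 ^ 2 + p 1 ^ 2 + p 2 ^ 2) ^ 3 *
    Matrix.det !![p 1 ^ 2 + p 2 ^ 2 - p 0 * p 2 * a (EuclideanSpace.single 0 1),
                    -p 0 * (p 1 + p 2 * a (EuclideanSpace.single 1 1));
                  -p 1 * (p 0 + p 2 * a (EuclideanSpace.single 0 1)),
                    p 0 ^ 2 + p 2 ^ 2 - p 1 * p 2 * a (EuclideanSpace.single 1 1)]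

lemma norm_sq_eq_three (p : E3) : ‖p‖ ^ 2 = p 0 ^ 2 + p 1 ^ 2 + p 2 ^ 2 := by
  rw [EuclideanSpace.norm_sq_eq, Fin.sum_univ_three]
  simp

lemma ContinuousLinearMap.det_eq_two (A : E2 →L[ℝ] E2) :
    A.det = A (EuclideanSpace.single 0 1) 0 * A (EuclideanSpace.single 1 1) 1 -
      A (EuclideanSpace.single 1 1) 0 * A (EuclideanSpace.single 0 1) 1 := by
  rw [ContinuousLinearMap.det,
    ← LinearMap.det_toMatrix (EuclideanSpace.basisFun (Fin 2) ℝ).toBasis, Matrix.det_fin_two]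
  simp [LinearMap.toMatrix_apply]

/-- In the coordinates `(x, y)` of a graph and `(u₁, u₂)` of the sphere, the radial projection is
differentiable with Jacobian determinant `radialJacobian`. -/
lemma exists_hasFDerivAt_planeProj_radialProj_graphMap {H : E2 → ℝ} {a : E2 →L[ℝ] ℝ} {q : E2}
    (hH : HasFDerivAt H a q) (h0 : graphMap H q ≠ 0) :
    ∃ T' : E2 →L[ℝ] E2, HasFDerivAt (fun q ↦ planeProj (radialProj (graphMap H q))) T' q ∧
      T'.det = radialJacobian (graphMap H q) a := by
  have hT (q : E2) : planeProj (radialProj (graphMap H q)) = ‖graphMap H q‖⁻¹ • q := by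
    ext i; fin_cases i <;> simp [radialProj]
  have hr : 0 < ‖graphMap H q‖ := norm_pos_iff.2 h0
  have hrsq (q : E2) : ‖graphMap H q‖ = √(q 0 ^ 2 + q 1 ^ 2 + H q ^ 2) := by
    rw [← Real.sqrt_sq (norm_nonneg (graphMap H q)), norm_sq_eq_three]
    rfl
  have hp (i : Fin 2) : HasFDerivAt (fun q : E2 ↦ q i) (EuclideanSpace.proj i : E2 →L[ℝ] ℝ) q :=
    (EuclideanSpace.proj i : E2 →L[ℝ] ℝ).hasFDerivAt
  have hS := (((hp 0).pow 2).add ((hp 1).pow 2)).add (hH.pow 2)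
  have hpos : 0 < q 0 ^ 2 + q 1 ^ 2 + H q ^ 2 := by
    have := pow_pos hr 2
    rwa [norm_sq_eq_three] at this
  have hN : HasFDerivAt (fun q ↦ ‖graphMap H q‖) _ q :=
    (hS.sqrt hpos.ne').congr_of_eventuallyEq (Eventually.of_forall hrsq)
  have hI := (hasDerivAt_inv hr.ne').comp_hasFDerivAt q hN
  have hD := hI.smul (hasFDerivAt_id q)
  refine ⟨_, hD.congr_of_eventuallyEq (Eventually.of_forall hT), ?_⟩
  rw [ContinuousLinearMap.det_eq_two, radialJacobian, Matrix.det_fin_two]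
  have hr2 : ‖graphMap H q‖ ^ 2 = q 0 ^ 2 + q 1 ^ 2 + H q ^ 2 := norm_sq_eq_three _
  have hs : √(q 0 ^ 2 + q 1 ^ 2 + H q ^ 2) = ‖graphMap H q‖ := (hrsq q).symm
  rw [← norm_sq_eq_three]
  set r := ‖graphMap H q‖
  simp [hs]
  have hx : q 1 ^ 2 + H q ^ 2 = r ^ 2 - q 0 ^ 2 := by linarith
  have hy : q 0 ^ 2 + H q ^ 2 = r ^ 2 - q 1 ^ 2 := by linarith
  rw [hx, hy]
  field_simp
  ring

/-- The upper (`σ = 1`) or lower (`σ = -1`) unit hemisphere as a graph over the unit disc. -/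
noncomputable def hemisphere (σ : ℝ) (v : E2) : ℝ := σ * √(1 - ‖v‖ ^ 2)

lemma graphMap_hemisphere_planeProj {σ : ℝ} (hσ : σ ^ 2 = 1) {u : E3} (hu : ‖u‖ = 1)
    (h : 0 < σ * u 2) : graphMap (hemisphere σ) (planeProj u) = u := by
  refine graphMap_planeProj ?_
  have h1 := norm_sq_eq_three u
  have h2 : ‖planeProj u‖ ^ 2 = u 0 ^ 2 + u 1 ^ 2 := by
    rw [EuclideanSpace.norm_sq_eq, Fin.sum_univ_two]
    simp
  rw [hu] at h1
  have h3 : 1 - ‖planeProj u‖ ^ 2 = (σ * u 2) ^ 2 := by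
    rw [h2, mul_pow, hσ]; linarith
  rw [hemisphere, h3, Real.sqrt_sq h.le, ← mul_assoc, ← sq, hσ, one_mul]

lemma hasFDerivAt_hemisphere_and_slopeDensity {σ : ℝ} (hσ : σ ^ 2 = 1) {v : E2} (hv : ‖v‖ ^ 2 < 1) :
    HasFDerivAt (hemisphere σ) (fderiv ℝ (hemisphere σ) v) v ∧
      slopeDensity (fderiv ℝ (hemisphere σ) v) = (√(1 - ‖v‖ ^ 2))⁻¹ := by
  have hpos : 0 < 1 - ‖v‖ ^ 2 := by linarith
  have h1 : HasFDerivAt (fun v : E2 ↦ ‖v‖ ^ 2) (2 • innerSL ℝ v) v := by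
    simpa using (hasFDerivAt_id v).norm_sq
  have h2 := ((h1.const_sub 1).sqrt hpos.ne').const_mul σ
  have h3 : HasFDerivAt (hemisphere σ) _ v := h2
  rw [h3.fderiv]
  refine ⟨h3, ?_⟩
  have hn : ‖v‖ ^ 2 = v 0 ^ 2 + v 1 ^ 2 := by
    rw [EuclideanSpace.norm_sq_eq, Fin.sum_univ_two]
    simp
  rw [slopeDensity, ← Real.sqrt_inv]
  congr 1
  set w := √(1 - ‖v‖ ^ 2) with hw
  have hw0 : 0 < w := Real.sqrt_pos.2 hpos
  have hw2 : 1 - ‖v‖ ^ 2 = w ^ 2 := (Real.sq_sqrt hpos.le).symm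
  rw [hw2]
  have : v 0 ^ 2 + v 1 ^ 2 = 1 - w ^ 2 := by linarith
  simp [EuclideanSpace.inner_single_right]
  field_simp
  rw [hσ]
  linarith

end PlanarMap

/-! ### Change of variables on one side of the equator -/

section SurfaceIntegral

variable {H : E2 → ℝ}

/-- Change of variables under the radial projection of a piece of a graph lying strictly on one
side of the plane `z = 0`: both the image, a piece of a hemisphere, and the planar map between
the two parameter domains are accessible to the planar change of variables formula. -/
lemma setLIntegral_radialProj_image_graphMap {H' : E2 → E2 →L[ℝ] ℝ} {s : Set E2} {σ : ℝ}
    (hσ : σ ^ 2 = 1) (hs : MeasurableSet s) (hH' : ∀ q ∈ s, HasFDerivAt H (H' q) q)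
    (hpos : ∀ q ∈ s, 0 < σ * H q) (hinj : InjOn radialProj (graphMap H '' s)) (F : E3 → ℝ≥0∞) :
    ∫⁻ u in radialProj '' (graphMap H '' s), F u ∂(μHE[2] : Measure E3) =
      ∫⁻ q in s, ENNReal.ofReal ((√(1 - ‖planeProj (radialProj (graphMap H q))‖ ^ 2))⁻¹ *
        |radialJacobian (graphMap H q) (H' q)|) * F (radialProj (graphMap H q)) := by
  set T : E2 → E2 := fun q ↦ planeProj (radialProj (graphMap H q)) with hTdef
  have hne (q) (hq : q ∈ s) : graphMap H q ≠ 0 := by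
    intro h
    have := hpos q hq
    rw [← graphMap_two H q, h] at this
    simp at this
  have hu (q) (hq : q ∈ s) : 0 < σ * radialProj (graphMap H q) 2 := by
    have h1 : radialProj (graphMap H q) 2 = ‖graphMap H q‖⁻¹ * H q := by simp [radialProj]
    rw [h1, mul_left_comm]
    exact mul_pos (inv_pos.2 (norm_pos_iff.2 (hne q hq))) (hpos q hq)
  have hgT (q) (hq : q ∈ s) : graphMap (hemisphere σ) (T q) = radialProj (graphMap H q) :=
    graphMap_hemisphere_planeProj hσ (norm_radialProj (hne q hq)) (hu q hq)
  have hT1 (q) (hq : q ∈ s) : ‖T q‖ ^ 2 < 1 := by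
    have h1 := norm_sq_eq_three (radialProj (graphMap H q))
    rw [norm_radialProj (hne q hq)] at h1
    have h2 : ‖T q‖ ^ 2 = radialProj (graphMap H q) 0 ^ 2 + radialProj (graphMap H q) 1 ^ 2 := by
      rw [EuclideanSpace.norm_sq_eq, Fin.sum_univ_two]
      simp [hTdef]
    have h3 : radialProj (graphMap H q) 2 ≠ 0 := by
      intro h
      have := hu q hq
      simp [h] at this
    have := pow_pos (abs_pos.2 h3) 2
    rw [sq_abs] at this
    linarith
  -- A derivative of `T` at the points of `s`, with the value `0` elsewhere.
  have hT' : ∀ q, ∃ T' : E2 →L[ℝ] E2, q ∈ s →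
      HasFDerivAt T T' q ∧ T'.det = radialJacobian (graphMap H q) (H' q) := by
    intro q
    by_cases hq : q ∈ s
    · obtain ⟨T', h⟩ := exists_hasFDerivAt_planeProj_radialProj_graphMap (hH' q hq) (hne q hq)
      exact ⟨T', fun _ ↦ h⟩
    · exact ⟨0, fun h ↦ absurd h hq⟩
  choose T' hT' using hT'
  have hTw : ∀ q ∈ s, HasFDerivWithinAt T (T' q) s q :=
    fun q hq ↦ (hT' q hq).1.hasFDerivWithinAt
  -- A point of the hemisphere is determined by its first two coordinates.
  have hTinj : InjOn T s := by
    intro q hq q' hq' h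
    have h1 : radialProj (graphMap H q) = radialProj (graphMap H q') := by
      rw [← hgT q hq, ← hgT q' hq', h]
    exact graphMap_injective H (hinj (mem_image_of_mem _ hq) (mem_image_of_mem _ hq') h1)
  have himg : radialProj '' (graphMap H '' s) = graphMap (hemisphere σ) '' (T '' s) := by
    rw [← image_comp, ← image_comp]
    exact image_congr fun q hq ↦ (hgT q hq).symm
  have hTs : MeasurableSet (T '' s) := measurable_image_of_fderivWithin hs hTw hTinj
  have hhem : ∀ v ∈ T '' s, HasFDerivWithinAt (hemisphere σ) (fderiv ℝ (hemisphere σ) v)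
      (T '' s) v := by
    rintro _ ⟨q, hq, rfl⟩
    exact (hasFDerivAt_hemisphere_and_slopeDensity hσ (hT1 q hq)).1.hasFDerivWithinAt
  rw [himg, setLIntegral_image_graphMap hTs hhem,
    lintegral_image_eq_lintegral_abs_det_fderiv_mul volume hs hTw hTinj]
  refine setLIntegral_congr_fun hs fun q hq ↦ ?_
  rw [(hasFDerivAt_hemisphere_and_slopeDensity hσ (hT1 q hq)).2, (hT' q hq).2, hgT q hq,
    ← mul_assoc, ← ENNReal.ofReal_mul (abs_nonneg _), mul_comm |_|]

variable {B : Set E3}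

lemma graphMap_image_planeProj_image (hB : ∀ p ∈ B, p 2 = H (planeProj p)) :
    graphMap H '' (planeProj '' B) = B := by
  rw [← image_comp]
  exact (image_congr fun p hp ↦ graphMap_planeProj (hB p hp)).trans (image_id' B)

lemma measurableSet_planeProj_image (hBm : MeasurableSet B)
    (hB : ∀ p ∈ B, p 2 = H (planeProj p)) : MeasurableSet (planeProj '' B) := by
  refine hBm.image_of_continuousOn_injOn continuous_planeProj.continuousOn ?_
  exact LeftInvOn.injOn fun p hp ↦ graphMap_planeProj (hB p hp)

/-- The density of the transformed intensity, relative to the original one, at the radial projection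
of the point `p` of the graph of a function with derivative `a`. It has the value `0` where the
Jacobian vanishes. -/
noncomputable def radialDensity (p : E3) (a : E2 →L[ℝ] ℝ) : ℝ :=
  slopeDensity a * |1 / radialJacobian p a| * √(1 - radialProj p 0 ^ 2 - radialProj p 1 ^ 2)

lemma radialProj_sq_lt_one {p : E3} (hp : p 2 ≠ 0) :
    ‖planeProj (radialProj p)‖ ^ 2 = radialProj p 0 ^ 2 + radialProj p 1 ^ 2 ∧
      radialProj p 0 ^ 2 + radialProj p 1 ^ 2 < 1 := by
  have hp0 : p ≠ 0 := by rintro rfl; simp at hp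
  constructor
  · rw [EuclideanSpace.norm_sq_eq, Fin.sum_univ_two]
    simp
  · have h1 := norm_sq_eq_three (radialProj p)
    rw [norm_radialProj hp0] at h1
    have h2 : radialProj p 2 ≠ 0 := by
      simp [radialProj, hp, hp0]
    have := pow_pos (abs_pos.2 h2) 2
    rw [sq_abs] at this
    linarith

/-- On a piece of a graph on one side of `z = 0` with non-vanishing Jacobian, the integral of
a function over the piece is that of the transformed function over the radial image. -/
lemma setLIntegral_radialProj_image_of_pos {σ : ℝ} (hσ : σ ^ 2 = 1) (hBm : MeasurableSet B)
    (hB : ∀ p ∈ B, p 2 = H (planeProj p)) (hdiff : ∀ p ∈ B, DifferentiableAt ℝ H (planeProj p))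
    (hpos : ∀ p ∈ B, 0 < σ * p 2) (hinj : InjOn radialProj B)
    (hJ : ∀ p ∈ B, radialJacobian p (fderiv ℝ H (planeProj p)) ≠ 0)
    {ρ ρ' : E3 → ℝ} (hρ : ∀ p ∈ B, ρ' (radialProj p) =
      ρ p * radialDensity p (fderiv ℝ H (planeProj p))) :
    ∫⁻ u in radialProj '' B, ENNReal.ofReal (ρ' u) ∂(μHE[2] : Measure E3) =
      ∫⁻ p in B, ENNReal.ofReal (ρ p) ∂(μHE[2] : Measure E3) := by
  have hBi := graphMap_image_planeProj_image hB
  have hs := measurableSet_planeProj_image hBm hB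
  have hd : ∀ q ∈ planeProj '' B, HasFDerivAt H (fderiv ℝ H q) q := by
    rintro _ ⟨p, hp, rfl⟩
    exact (hdiff p hp).hasFDerivAt
  have h1 := setLIntegral_radialProj_image_graphMap hσ hs hd
    (by rintro _ ⟨p, hp, rfl⟩; rw [← hB p hp]; exact hpos p hp) (by rwa [hBi])
    (fun u ↦ ENNReal.ofReal (ρ' u))
  have h2 := setLIntegral_image_graphMap hs (fun q hq ↦ (hd q hq).hasFDerivWithinAt)
    (fun p ↦ ENNReal.ofReal (ρ p))
  rw [hBi] at h1 h2
  rw [h1, h2]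
  refine setLIntegral_congr_fun hs ?_
  rintro _ ⟨p, hp, rfl⟩
  simp only
  rw [graphMap_planeProj (hB p hp), hρ p hp, radialDensity]
  have hp2 : p 2 ≠ 0 := by
    intro h
    have := hpos p hp
    simp [h] at this
  obtain ⟨h3, h4⟩ := radialProj_sq_lt_one hp2
  rw [h3, ← sub_sub]
  have h5 : 0 < √(1 - radialProj p 0 ^ 2 - radialProj p 1 ^ 2) := Real.sqrt_pos.2 (by linarith)
  have h6 := abs_pos.2 (hJ p hp)
  have h7 : 0 < slopeDensity (fderiv ℝ H (planeProj p)) :=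
    zero_lt_one.trans_le (one_le_slopeDensity _)
  rw [← ENNReal.ofReal_mul (by positivity), ← ENNReal.ofReal_mul h7.le, abs_div, abs_one]
  congr 1
  field_simp

/-- The part of a graph, strictly on one side of `z = 0`, where the Jacobian vanishes has null
radial image. -/
lemma hausdorff_radialProj_image_eq_zero_of_jacobian {σ : ℝ} (hσ : σ ^ 2 = 1)
    (hBm : MeasurableSet B) (hB : ∀ p ∈ B, p 2 = H (planeProj p))
    (hdiff : ∀ p ∈ B, DifferentiableAt ℝ H (planeProj p))
    (hpos : ∀ p ∈ B, 0 < σ * p 2) (hinj : InjOn radialProj B)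
    (hJ : ∀ p ∈ B, radialJacobian p (fderiv ℝ H (planeProj p)) = 0) :
    (μHE[2] : Measure E3) (radialProj '' B) = 0 := by
  have hBi := graphMap_image_planeProj_image hB
  have hs := measurableSet_planeProj_image hBm hB
  have h1 := setLIntegral_radialProj_image_graphMap hσ hs (H' := fderiv ℝ H)
    (by rintro _ ⟨p, hp, rfl⟩; exact (hdiff p hp).hasFDerivAt)
    (by rintro _ ⟨p, hp, rfl⟩; rw [← hB p hp]; exact hpos p hp) (by rwa [hBi]) (fun _ ↦ 1)
  rw [hBi, setLIntegral_one] at h1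
  rw [h1]
  refine (setLIntegral_congr_fun hs (g := fun _ ↦ 0) ?_).trans (by simp)
  rintro _ ⟨p, hp, rfl⟩
  simp only
  rw [graphMap_planeProj (hB p hp), hJ p hp]
  simp

/-- The equator is a circle in the plane `z = 0`, on which the area is Lebesgue measure. -/
lemma hausdorff_equator : (μHE[2] : Measure E3) {u | ‖u‖ = 1 ∧ u 2 = 0} = 0 := by
  have h1 : {u : E3 | ‖u‖ = 1 ∧ u 2 = 0} ⊆
      graphMap (0 : E2 →L[ℝ] ℝ) '' Metric.sphere (0 : E2) 1 := by
    rintro u ⟨hu, hu2⟩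
    refine ⟨planeProj u, ?_, graphMap_planeProj (by simpa using hu2)⟩
    have h2 := norm_sq_eq_three u
    have h3 : ‖planeProj u‖ ^ 2 = 1 := by
      rw [EuclideanSpace.norm_sq_eq, Fin.sum_univ_two]
      rw [hu, hu2] at h2
      simp
      linarith
    exact mem_sphere_zero_iff_norm.2 ((pow_eq_one_iff_of_nonneg
      (norm_nonneg _) two_ne_zero).1 h3)
  refine measure_mono_null h1 ?_
  rw [hausdorff_image_graphMap_linear, Measure.addHaar_sphere, mul_zero]

end SurfaceIntegral

/-! ### Change of variables on a piece of the surface -/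

section Piece

lemma measurable_fderiv_planeProj_single (H : E2 → ℝ) (i : Fin 2) :
    Measurable fun p : E3 ↦ fderiv ℝ H (planeProj p) (EuclideanSpace.single i 1) :=
  (measurable_fderiv_apply_const ℝ H _).comp continuous_planeProj.measurable

lemma measurable_radialJacobian (H : E2 → ℝ) :
    Measurable fun p : E3 ↦ radialJacobian p (fderiv ℝ H (planeProj p)) := by
  have h (i : Fin 2) := measurable_fderiv_planeProj_single H i
  have hc (i : Fin 3) : Measurable fun p : E3 ↦ p i :=
    (PiLp.continuous_apply 2 (fun _ : Fin 3 ↦ ℝ) i).measurable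
  simp only [radialJacobian, Matrix.det_fin_two, Matrix.of_apply, Matrix.cons_val',
    Matrix.cons_val_zero, Matrix.cons_val_one, Matrix.cons_val_fin_one]
  fun_prop

lemma measurable_radialDensity (H : E2 → ℝ) :
    Measurable fun p : E3 ↦ radialDensity p (fderiv ℝ H (planeProj p)) := by
  have h (i : Fin 2) := measurable_fderiv_planeProj_single H i
  have hJ := measurable_radialJacobian H
  have hc (i : Fin 3) : Measurable fun p : E3 ↦ radialProj p i :=
    (PiLp.continuous_apply 2 (fun _ : Fin 3 ↦ ℝ) i).measurable.comp measurable_radialProj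
  have h1 : Measurable fun p : E3 ↦ |1 / radialJacobian p (fderiv ℝ H (planeProj p))| :=
    measurable_norm.comp (hJ.const_div 1)
  simp only [radialDensity, slopeDensity]
  fun_prop

variable {K : Set E3} {H : E2 → ℝ} {B : Set E3}

/-- For a Borel part of the boundary contained in the graph of an almost everywhere differentiable
function, the integral of the intensity over it equals the integral of the transformed intensity
over its radial image. The equator `z = 0` and the zero set of the Jacobian are negligible on
both surfaces. -/
theorem setLIntegral_radialProj_image (hK : Convex ℝ K) (hKb : Bornology.IsBounded K)
    (hK0 : (0 : E3) ∈ interior K) (hBm : MeasurableSet B) (hBK : B ⊆ frontier K)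
    (hB : ∀ p ∈ B, p 2 = H (planeProj p))
    (hdiff : (μHE[2] : Measure E3) (B ∩ {p | ¬DifferentiableAt ℝ H (planeProj p)}) = 0)
    {ρ ρ' : E3 → ℝ} (hρ : ∀ p ∈ B, DifferentiableAt ℝ H (planeProj p) →
      ρ' (radialProj p) = ρ p * radialDensity p (fderiv ℝ H (planeProj p))) :
    ∫⁻ u in radialProj '' B, ENNReal.ofReal (ρ' u) ∂(μHE[2] : Measure E3) =
      ∫⁻ p in B, ENNReal.ofReal (ρ p) ∂(μHE[2] : Measure E3) := by
  have hinj := injOn_radialProj_frontier hK hK0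
  set J : E3 → ℝ := fun p ↦ radialJacobian p (fderiv ℝ H (planeProj p)) with hJdef
  have hJm : Measurable J := measurable_radialJacobian H
  set Df : Set E3 := {p | DifferentiableAt ℝ H (planeProj p)} with hDf
  -- The set of differentiability points of any function, measurable or not, is Borel.
  have hDfm : MeasurableSet Df :=
    continuous_planeProj.measurable (measurableSet_of_differentiableAt ℝ H)
  have hzm : Measurable fun p : E3 ↦ p 2 :=
    (PiLp.continuous_apply 2 (fun _ : Fin 3 ↦ ℝ) 2).measurable
  -- `side σ` is the differentiable part of `B` in the open half-space `0 < σ z`.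
  set side : ℝ → Set E3 := fun σ ↦ B ∩ Df ∩ {p | 0 < σ * p 2} with hside
  have hsm (σ : ℝ) : MeasurableSet (side σ) :=
    (hBm.inter hDfm).inter (measurableSet_lt measurable_const (hzm.const_mul σ))
  have hsB (σ : ℝ) : side σ ⊆ B := fun p hp ↦ hp.1.1
  have hJ0 : MeasurableSet {p | J p = 0} := hJm (measurableSet_singleton 0)
  set good : ℝ → Set E3 := fun σ ↦ side σ \ {p | J p = 0} with hgood
  have hgm (σ : ℝ) : MeasurableSet (good σ) := (hsm σ).diff hJ0
  have hgB (σ : ℝ) : good σ ⊆ B := sdiff_subset.trans (hsB σ)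
  have hgd : Disjoint (good 1) (good (-1)) := by
    rw [Set.disjoint_left]
    intro p hp hp'
    have h1 : 0 < 1 * p 2 := hp.1.2
    have h2 : 0 < -1 * p 2 := hp'.1.2
    linarith
  set G : Set E3 := good 1 ∪ good (-1) with hG
  have hGB : G ⊆ B := union_subset (hgB 1) (hgB (-1))
  -- The remaining part of `B` is negligible, and so is its image.
  have hnull : (μHE[2] : Measure E3) (B \ G) = 0 := by
    have hcov : B \ G ⊆ (B ∩ Dfᶜ) ∪ (B ∩ {p | p 2 = 0}) ∪
        ((side 1 ∩ {p | J p = 0}) ∪ (side (-1) ∩ {p | J p = 0})) := by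
      rintro p ⟨hp, hpG⟩
      by_cases h1 : p ∈ Df
      swap
      · exact Or.inl (Or.inl ⟨hp, h1⟩)
      rcases lt_trichotomy (p 2) 0 with h2 | h2 | h2
      · have h3 : p ∈ side (-1) := ⟨⟨hp, h1⟩, by simpa using h2⟩
        by_cases h4 : J p = 0
        · exact Or.inr (Or.inr ⟨h3, h4⟩)
        · exact absurd (Or.inr ⟨h3, h4⟩) hpG
      · exact Or.inl (Or.inr ⟨hp, h2⟩)
      · have h3 : p ∈ side 1 := ⟨⟨hp, h1⟩, by simpa using h2⟩
        by_cases h4 : J p = 0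
        · exact Or.inr (Or.inl ⟨h3, h4⟩)
        · exact absurd (Or.inl ⟨h3, h4⟩) hpG
    have hJnull {σ : ℝ} (hσ : σ ^ 2 = 1) :
        (μHE[2] : Measure E3) (side σ ∩ {p | J p = 0}) = 0 := by
      have hsub : side σ ∩ {p | J p = 0} ⊆ frontier K :=
        inter_subset_left.trans ((hsB σ).trans hBK)
      refine hausdorff_eq_zero_of_radialProj_image hK hKb hK0 hsub ?_
      exact hausdorff_radialProj_image_eq_zero_of_jacobian hσ ((hsm σ).inter hJ0)
        (fun p hp ↦ hB p (hsB σ hp.1)) (fun p hp ↦ hp.1.1.2) (fun p hp ↦ hp.1.2)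
        (hinj.mono hsub) fun p hp ↦ hp.2
    have hE : (μHE[2] : Measure E3) (B ∩ {p | p 2 = 0}) = 0 := by
      refine hausdorff_eq_zero_of_radialProj_image hK hKb hK0 (inter_subset_left.trans hBK) ?_
      refine measure_mono_null ?_ hausdorff_equator
      rintro _ ⟨p, ⟨hp, hp2⟩, rfl⟩
      have h2 : p 2 = 0 := hp2
      exact ⟨norm_radialProj (ne_zero_of_mem_frontier hK0 (hBK hp)), by simp [radialProj, h2]⟩
    exact measure_mono_null hcov (measure_union_null (measure_union_null hdiff hE)
      (measure_union_null (hJnull (by norm_num)) (hJnull (by norm_num))))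
  have hnull' : (μHE[2] : Measure E3) (radialProj '' B \ radialProj '' G) = 0 := by
    rw [← (hinj.mono hBK).image_sdiff_subset hGB]
    exact hausdorff_radialProj_image_eq_zero hK0 (sdiff_subset.trans hBK) hnull
  have hae : B =ᵐ[(μHE[2] : Measure E3)] G :=
    (ae_le_set.2 hnull).antisymm (LE.le.eventuallyLE hGB)
  have hae' : radialProj '' B =ᵐ[(μHE[2] : Measure E3)] radialProj '' G :=
    (ae_le_set.2 hnull').antisymm (LE.le.eventuallyLE (image_mono hGB))
  have hgi (σ : ℝ) : InjOn radialProj (good σ) := hinj.mono ((hgB σ).trans hBK)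
  have hgood_eq {σ : ℝ} (hσ : σ ^ 2 = 1) :
      ∫⁻ u in radialProj '' good σ, ENNReal.ofReal (ρ' u) ∂(μHE[2] : Measure E3) =
        ∫⁻ p in good σ, ENNReal.ofReal (ρ p) ∂(μHE[2] : Measure E3) :=
    setLIntegral_radialProj_image_of_pos hσ (hgm σ) (fun p hp ↦ hB p (hgB σ hp))
      (fun p hp ↦ hp.1.1.2) (fun p hp ↦ hp.1.2) (hgi σ) (fun p hp ↦ hp.2)
      fun p hp ↦ hρ p (hgB σ hp) hp.1.1.2
  rw [setLIntegral_congr hae, setLIntegral_congr hae', hG, image_union,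
    lintegral_union ((hgm _).image_of_measurable_injOn measurable_radialProj (hgi _))
      (hgd.image hinj ((hgB 1).trans hBK) ((hgB (-1)).trans hBK)),
    lintegral_union (hgm _) hgd, hgood_eq (by norm_num), hgood_eq (by norm_num)]

end Piece

/-! ### The transformed intensity and the Poisson process -/

section Intensity

/-- A function of two real variables as a function on the Euclidean plane. -/
def planeFun (h : ℝ → ℝ → ℝ) (q : E2) : ℝ := h (q 0) (q 1)

variable {h : ℝ → ℝ → ℝ} {p : E3}

lemma differentiableAt_planeFun
    (hd : DifferentiableAt ℝ (fun q : ℝ × ℝ ↦ h q.1 q.2) (p 0, p 1)) :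
    DifferentiableAt ℝ (planeFun h) (planeProj p) := by
  have h1 : DifferentiableAt ℝ (fun q : E2 ↦ (q 0, q 1)) (planeProj p) := by fun_prop
  exact DifferentiableAt.comp (planeProj p)
    (g := fun q : ℝ × ℝ ↦ h q.1 q.2) (f := fun q : E2 ↦ (q 0, q 1)) hd h1

lemma partialX_eq_fderiv (hd : DifferentiableAt ℝ (planeFun h) (planeProj p)) :
    partialX h (p 0) (p 1) = fderiv ℝ (planeFun h) (planeProj p) (EuclideanSpace.single 0 1) := by
  have hc : HasDerivAt (fun t : ℝ ↦ t • (EuclideanSpace.single 0 1 : E2) +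
      p 1 • (EuclideanSpace.single 1 1 : E2)) (EuclideanSpace.single 0 1) (p 0) := by
    simpa using ((hasDerivAt_id (p 0)).smul_const (EuclideanSpace.single 0 1 : E2)).add_const
      (p 1 • (EuclideanSpace.single 1 1 : E2))
  have hp : p 0 • (EuclideanSpace.single 0 1 : E2) + p 1 • (EuclideanSpace.single 1 1 : E2) =
      planeProj p := by
    ext i; fin_cases i <;> simp
  have := (hp ▸ hd.hasFDerivAt).comp_hasDerivAt (p 0) hc
  rw [partialX, ← hp, ← this.deriv]
  congr 1
  ext t
  simp [planeFun]

lemma partialY_eq_fderiv (hd : DifferentiableAt ℝ (planeFun h) (planeProj p)) :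
    partialY h (p 0) (p 1) = fderiv ℝ (planeFun h) (planeProj p) (EuclideanSpace.single 1 1) := by
  have hc : HasDerivAt (fun t : ℝ ↦ p 0 • (EuclideanSpace.single 0 1 : E2) +
      t • (EuclideanSpace.single 1 1 : E2)) (EuclideanSpace.single 1 1) (p 1) := by
    simpa using ((hasDerivAt_id (p 1)).smul_const (EuclideanSpace.single 1 1 : E2)).const_add
      (p 0 • (EuclideanSpace.single 0 1 : E2))
  have hp : p 0 • (EuclideanSpace.single 0 1 : E2) + p 1 • (EuclideanSpace.single 1 1 : E2) =
      planeProj p := by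
    ext i; fin_cases i <;> simp
  have := (hp ▸ hd.hasFDerivAt).comp_hasDerivAt (p 1) hc
  rw [partialY, ← hp, ← this.deriv]
  congr 1
  ext t
  simp [planeFun]

lemma pieceIntensity_radialProj {D : Set E3} {ρ : E3 → ℝ} (hinj : InjOn radialProj D)
    (hp : p ∈ D) (hz : p 2 = h (p 0) (p 1))
    (hd : DifferentiableAt ℝ (planeFun h) (planeProj p)) :
    pieceIntensity D ρ h (radialProj p) =
      ρ p * radialDensity p (fderiv ℝ (planeFun h) (planeProj p)) := by
  have hinv : invFunOn radialProj D (radialProj p) = p := hinj.leftInvOn_invFunOn hp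
  have h1 : areaFactor h p = slopeDensity (fderiv ℝ (planeFun h) (planeProj p)) := by
    rw [areaFactor, slopeDensity, partialX_eq_fderiv hd, partialY_eq_fderiv hd]
  have h2 : planarJacobian h p =
      radialJacobian p (fderiv ℝ (planeFun h) (planeProj p)) := by
    simp only [planarJacobian, radialJacobian, partialX_eq_fderiv hd, partialY_eq_fderiv hd, hz]
  simp only [pieceIntensity, hinv, h1, h2, radialDensity]
  ring

lemma pieceIntensity_nonneg {D : Set E3} {ρ : E3 → ℝ} (hinj : InjOn radialProj D) (hp : p ∈ D)
    (hρ : 0 ≤ ρ p) : 0 ≤ pieceIntensity D ρ h (radialProj p) := by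
  have hinv : invFunOn radialProj D (radialProj p) = p := hinj.leftInvOn_invFunOn hp
  simp only [pieceIntensity, hinv]
  have : 0 ≤ areaFactor h p := Real.sqrt_nonneg _
  positivity

variable {K B : Set E3} {ρ : E3 → ℝ}

/-- The inverse of the radial projection pulls null subsets of the boundary back to null
subsets of the sphere. -/
lemma quasiMeasurePreserving_radialInv (hK : Convex ℝ K) (hK0 : (0 : E3) ∈ interior K)
    (hBK : B ⊆ frontier K) :
    Measure.QuasiMeasurePreserving (radialInv K)
      ((μHE[2] : Measure E3).restrict (radialProj '' B)) ((μHE[2] : Measure E3).restrict B) := by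
  have hg := measurable_radialInv hK hK0
  refine ⟨hg, Measure.AbsolutelyContinuous.mk fun N hN h0 ↦ ?_⟩
  rw [Measure.restrict_apply hN] at h0
  rw [Measure.map_apply hg hN, Measure.restrict_apply (hg hN)]
  refine measure_mono_null ?_ (hausdorff_radialProj_image_eq_zero hK0
    (inter_subset_right.trans hBK) h0)
  rintro _ ⟨hx, p, hp, rfl⟩
  rw [mem_preimage, radialInv_radialProj hK hK0 (hBK hp)] at hx
  exact mem_image_of_mem _ ⟨hx, hp⟩

/-- No measurability is assumed of `h`; the partial derivatives entering the intensity are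
measurable all the same, as the derivative of an arbitrary function is. -/
lemma aemeasurable_pieceIntensity (hK : Convex ℝ K) (hK0 : (0 : E3) ∈ interior K)
    (hBm : MeasurableSet B) (hBK : B ⊆ frontier K) (hB : ∀ p ∈ B, p 2 = h (p 0) (p 1))
    (hdiff : (μHE[2] : Measure E3)
      (B ∩ {p | ¬DifferentiableAt ℝ (planeFun h) (planeProj p)}) = 0)
    (hρ : AEMeasurable ρ ((μHE[2] : Measure E3).restrict B)) :
    AEMeasurable (pieceIntensity (frontier K) ρ h)
      ((μHE[2] : Measure E3).restrict (radialProj '' B)) := by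
  have hinj := injOn_radialProj_frontier hK hK0
  have hq := quasiMeasurePreserving_radialInv hK hK0 hBK
  have h1 : AEMeasurable (fun u ↦ ρ (radialInv K u))
      ((μHE[2] : Measure E3).restrict (radialProj '' B)) := hρ.comp_quasiMeasurePreserving hq
  have h2 := ((measurable_radialDensity (planeFun h)).comp hq.measurable).aemeasurable
    (μ := (μHE[2] : Measure E3).restrict (radialProj '' B))
  refine (h1.mul h2).congr ?_
  have hBi : MeasurableSet (radialProj '' B) :=
    hBm.image_of_measurable_injOn measurable_radialProj (hinj.mono hBK)
  have hnull := hausdorff_radialProj_image_eq_zero hK0 (inter_subset_left.trans hBK) hdiff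
  have hae := measure_eq_zero_iff_ae_notMem.1 hnull
  -- Where `h` is not differentiable, its partial derivatives carry no information; the radial image
  -- of this set is null.
  filter_upwards [ae_restrict_mem hBi, ae_restrict_of_ae hae] with u hu hu'
  obtain ⟨p, hp, rfl⟩ := hu
  have hd : DifferentiableAt ℝ (planeFun h) (planeProj p) := by
    by_contra hd
    exact hu' (mem_image_of_mem _ ⟨hp, hd⟩)
  simp only [Pi.mul_apply, comp_apply]
  rw [radialInv_radialProj hK hK0 (hBK hp), pieceIntensity_radialProj hinj (hBK hp) (hB p hp) hd]

end Intensity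

section PoissonProcess

variable {Ω : Type*} [MeasurableSpace Ω] {S S' : Set E3} {X : Ω → Set E3} {f : E3 → E3}

/-- The points of the image process in `C` are counted by the points of the original one in the
preimage of `C`. -/
lemma encard_image_inter (hf : InjOn f S) {A : Set E3} (hA : A ⊆ S) (C : Set E3) :
    (f '' A ∩ C).encard = (A ∩ (S ∩ f ⁻¹' C)).encard := by
  rw [← inter_assoc, inter_eq_left.2 hA, ← image_inter_preimage,
    (hf.mono (inter_subset_left.trans hA)).encard_image]

/-- The mapping theorem for Poisson processes: an injective Borel map carries a Poisson process on
a bounded surface to the Poisson process whose intensity has the transported mean measure. -/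
theorem IsPoissonProcess.image {P : Measure Ω} {ρ ρ' : E3 → ℝ} (hX : IsPoissonProcess P S ρ X)
    (hS : MeasurableSet S) (hSb : Bornology.IsBounded S) (hf : Measurable f) (hfi : InjOn f S)
    (hSS' : MapsTo f S S') (hnn : ∀ u ∈ S', 0 ≤ ρ' u)
    (hm : ∀ C : Set E3, MeasurableSet C → C ⊆ S' →
      AEMeasurable ρ' ((μHE[2] : Measure E3).restrict C))
    (hmean : ∀ C : Set E3, MeasurableSet C → C ⊆ S' →
      meanMeasure ρ' C = meanMeasure ρ (S ∩ f ⁻¹' C)) :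
    IsPoissonProcess P S' ρ' (fun ω ↦ f '' X ω) := by
  have hpre {C : Set E3} (hC : MeasurableSet C) : MeasurableSet (S ∩ f ⁻¹' C) := hS.inter (hf hC)
  have hcount (C : Set E3) (ω : Ω) : (f '' X ω ∩ C).encard = (X ω ∩ (S ∩ f ⁻¹' C)).encard :=
    encard_image_inter hfi (hX.subset ω) C
  refine { subset := ?_, locallyFinite := ?_, measurable_count := ?_, intensity_nonneg := hnn,
           intensity_integrable := ?_, count_law := ?_, count_indep := ?_ }
  · exact fun ω ↦ (hSS'.mono_left (hX.subset ω)).image_subset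
  · -- All of `X ω` lies in the bounded set `S`, so it is finite.
    intro ω B _
    have h1 := hX.locallyFinite ω S hSb
    rw [inter_eq_left.2 (hX.subset ω)] at h1
    exact (h1.image f).subset inter_subset_left
  · intro C hC _
    simp only [hcount]
    exact hX.measurable_count _ (hpre hC) inter_subset_left
  · intro C hC hCS _
    refine ⟨(hm C hC hCS).aestronglyMeasurable, ?_⟩
    have h1 := hX.intensity_integrable _ (hpre hC) inter_subset_left (hSb.subset inter_subset_left)
    have h2 : 0 ≤ᵐ[(μHE[2] : Measure E3).restrict (S ∩ f ⁻¹' C)] ρ :=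
      (ae_restrict_mem (hpre hC)).mono fun x hx ↦ hX.intensity_nonneg x hx.1
    have h3 : 0 ≤ᵐ[(μHE[2] : Measure E3).restrict C] ρ' :=
      (ae_restrict_mem hC).mono fun x hx ↦ hnn x (hCS hx)
    rw [hasFiniteIntegral_iff_ofReal h3]
    exact (hmean C hC hCS).trans_lt ((hasFiniteIntegral_iff_ofReal h2).1 h1.2)
  · intro C hC hCS hfin
    rw [hmean C hC hCS] at hfin ⊢
    simp only [hcount]
    exact hX.count_law _ (hpre hC) inter_subset_left hfin
  · intro k B hBm hBS hd
    simp only [hcount]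
    refine hX.count_indep k _ (fun j ↦ hpre (hBm j)) (fun j ↦ inter_subset_left) fun i j hij ↦ ?_
    exact ((hd hij).preimage f).mono inter_subset_right inter_subset_right

end PoissonProcess

theorem mainTheorem1 {Ω : Type*} [MeasurableSpace Ω] (P : Measure Ω) [IsProbabilityMeasure P]
    (K D : Set E3) (hKconv : Convex ℝ K) (hKbdd : Bornology.IsBounded K)
    (hK0 : (0 : E3) ∈ interior K) (hD : D = frontier K)
    (n : ℕ) (piece : Fin n → Set E3) (hmeas : ∀ i, MeasurableSet (piece i))
    (hcover : ⋃ i, piece i = D) (hdisj : Pairwise (Disjoint on piece))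
    (h : Fin n → ℝ → ℝ → ℝ) (hgraph : ∀ i, ∀ p ∈ piece i, p 2 = h i (p 0) (p 1))
    (hdiff : ∀ i, ∀ᵐ p ∂((μHE[2] : Measure E3).restrict (piece i)),
      DifferentiableAt ℝ (fun q : ℝ × ℝ => h i q.1 q.2) (p 0, p 1))
    (ρ : E3 → ℝ) (X : Ω → Set E3) (hX : IsPoissonProcess P D ρ X) :
    BijOn radialProj D (Metric.sphere 0 1) ∧
      ∃ ρstar : E3 → ℝ,
        (∀ i, ∀ u ∈ radialProj '' piece i, ρstar u = pieceIntensity D ρ (h i) u) ∧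
        IsPoissonProcess P (Metric.sphere 0 1) ρstar (fun ω => radialProj '' X ω) := by
  subst hD
  have hbij := bijOn_radialProj_frontier hKconv hKbdd hK0
  have hinj := hbij.injOn
  have hDm : MeasurableSet (frontier K) := isClosed_frontier.measurableSet
  have hDb : Bornology.IsBounded (frontier K) := hKbdd.closure.subset frontier_subset_closure
  have hsub (i) : piece i ⊆ frontier K := hcover ▸ subset_iUnion piece i
  have hnd (i) : (μHE[2] : Measure E3)
      (piece i ∩ {p | ¬DifferentiableAt ℝ (planeFun (h i)) (planeProj p)}) = 0 := by
    have h1 := (ae_restrict_iff' (hmeas i)).1 (hdiff i)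
    refine measure_mono_null ?_ (ae_iff.1 h1)
    rintro p ⟨hp, hp'⟩ hcontra
    exact hp' (differentiableAt_planeFun (hcontra hp))
  have hdisj' : Pairwise (Disjoint on fun i ↦ radialProj '' piece i) :=
    fun i j hij ↦ (hdisj hij).image hinj (hsub i) (hsub j)
  have himg_cover : ⋃ i, radialProj '' piece i = Metric.sphere 0 1 := by
    rw [← image_iUnion, hcover, hbij.image_eq]
  classical
  -- The transformed intensity is glued from the formulas on the disjoint images of the pieces.
  set ρstar : E3 → ℝ := fun u ↦
    ∑ i, (radialProj '' piece i).indicator (pieceIntensity (frontier K) ρ (h i)) u with hρstar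
  have hstar (i) (u) (hu : u ∈ radialProj '' piece i) :
      ρstar u = pieceIntensity (frontier K) ρ (h i) u := by
    rw [hρstar]
    simp only
    rw [Finset.sum_eq_single i _ (by simp), indicator_of_mem hu]
    intro j _ hj
    exact indicator_of_notMem (fun hu' ↦ Set.disjoint_left.1 (hdisj' hj) hu' hu) _
  refine ⟨hbij, ρstar, hstar, ?_⟩
  refine hX.image hDm hDb measurable_radialProj hinj hbij.mapsTo ?_ ?_ ?_
  · intro u hu
    obtain ⟨i, p, hp, rfl⟩ := mem_iUnion.1 (himg_cover ▸ hu)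
    rw [hstar i _ (mem_image_of_mem _ hp)]
    exact pieceIntensity_nonneg hinj (hsub i hp) (hX.intensity_nonneg p (hsub i hp))
  · intro C _ hCS
    have h1 : AEMeasurable ρstar
        ((μHE[2] : Measure E3).restrict (⋃ i, radialProj '' piece i)) := by
      refine aemeasurable_iUnion_iff.2 fun i ↦ ?_
      have hρ := (hX.intensity_integrable (piece i) (hmeas i) (hsub i)
        (hDb.subset (hsub i))).1.aemeasurable
      refine (aemeasurable_pieceIntensity hKconv hK0 (hmeas i) (hsub i) (hgraph i) (hnd i)
        hρ).congr ?_
      have hm : MeasurableSet (radialProj '' piece i) :=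
        (hmeas i).image_of_measurable_injOn measurable_radialProj (hinj.mono (hsub i))
      exact (ae_restrict_mem hm).mono fun u hu ↦ (hstar i u hu).symm
    rw [himg_cover] at h1
    exact h1.mono_set hCS
  · intro C hC hCS
    have hBm (i) : MeasurableSet (piece i ∩ radialProj ⁻¹' C) :=
      (hmeas i).inter (measurable_radialProj hC)
    have hBs (i) : piece i ∩ radialProj ⁻¹' C ⊆ frontier K := inter_subset_left.trans (hsub i)
    have hBd : Pairwise (Disjoint on fun i ↦ piece i ∩ radialProj ⁻¹' C) :=
      fun i j hij ↦ (hdisj hij).mono inter_subset_left inter_subset_left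
    have e1 : frontier K ∩ radialProj ⁻¹' C = ⋃ i, piece i ∩ radialProj ⁻¹' C := by
      rw [← iUnion_inter, hcover]
    have e2 : C = ⋃ i, radialProj '' (piece i ∩ radialProj ⁻¹' C) := by
      simp only [image_inter_preimage]
      rw [← iUnion_inter, himg_cover, inter_eq_right.2 hCS]
    rw [e1]
    conv_lhs => rw [e2]
    rw [meanMeasure, meanMeasure, lintegral_iUnion hBm hBd,
      lintegral_iUnion (fun i ↦ (hBm i).image_of_measurable_injOn measurable_radialProj
        (hinj.mono (hBs i))) (fun i j hij ↦ (hBd hij).image hinj (hBs i) (hBs j))]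
    refine tsum_congr fun i ↦ ?_
    refine setLIntegral_radialProj_image hKconv hKbdd hK0 (hBm i) (hBs i)
      (fun p hp ↦ hgraph i p hp.1)
      (measure_mono_null (inter_subset_inter_left _ inter_subset_left) (hnd i)) ?_
    intro p hp hd
    rw [hstar i _ (mem_image_of_mem _ hp.1)]
    exact pieceIntensity_radialProj hinj (hBs i hp) (hgraph i p hp.1) hd
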